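/- Let $\kappa$ be an uncountable cardinal with $\kappa^{<\kappa}=\kappa$. Give $2^\kappa$ (the set of functions $\kappa\to\{0,1\}$) the topology generated by the sets $N_p=\{\eta\in 2^\kappa\mid \eta\restriction\alpha=p\}$, $\alpha<\kappa$, $p\in 2^\alpha$. Borel sets are the members of the smallest class containing the open sets and closed under complements and under unions and intersections of length at most $\kappa$ (on $2^\kappa$ and on $2^\kappa\times 2^\kappa$ with the product topology); a function $f\colon 2^\kappa\to2^\kappa$ is Borel if inverse images of open sets are Borel. For equivalence relations $E,E'$ on $2^\kappa$ write $E\le_B E'$ if there is a Borel function $f\colon 2^\kappa\to2^\kappa$ with $\eta\,E\,\xi\iff f(\eta)\,E'\,f(\xi)$ for all $\eta,\xi$. A set $C\subseteq\kappa$ is $\omega$-cub if it is unbounded in $\kappa$ and contains the supremum of every strictly increasing $\omega$-sequence of its elements; $S\subseteq\kappa$ is $\omega$-stationary if it meets every $\omega$-cub set. For a set $S\subseteq\kappa$ of (nonzero) limit ordinals let $E_S$ be the relation on $2^\kappa$ such that $\eta\,E_S\,\xi$ if and only if $\{\alpha<\kappa\mid\eta(\alpha)\ne\xi(\alpha)\}$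 is bounded in $\kappa$ and for every $\alpha\in S$ there is $\beta<\alpha$ such that either $\eta(\gamma)=\xi(\gamma)$ for all $\gamma\in(\beta,\alpha)$, or $\eta(\gamma)\neq\xi(\gamma)$ for all $\gamma\in(\beta,\alpha)$. Then there is an antichain of size $2^\kappa$ of Borel equivalence relations on $2^\kappa$, that is, a family of $2^\kappa$ Borel equivalence relations which are pairwise incomparable with respect to $\le_B$. More precisely, there are pairwise disjoint $\omega$-stationary sets $S_i$ ($i<\kappa$) of limit ordinals below $\kappa$ and a bijection $f\colon\kappa\times2\to\kappa$ such that, with $$A_\eta=\{(\alpha,n)\in\kappa\times 2\mid (n=0\wedge\eta(\alpha)=1)\vee(n=1\wedge\eta(\alpha)=0)\},\qquad S_\eta=\bigcup_{i\in f[A_\eta]}S_i\qquad(\eta\in2^\kappa),$$ every $E_{S_\eta}$ is a Borel equivalence relation, $E_{S_\eta}\not\le_B E_{S_\xi}$ whenever $\eta\ne\xi$, and the set $\{E_{S_\eta}\mid\eta\in2^\kappa\}$ has cardinality $2^\kappa$. -/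

import Mathlib

open Cardinal Set

universe u

namespace GenCantor

/-- The cardinal `κ`, regarded as the well-ordered set of all ordinals below it. -/
abbrev Below (κ : Cardinal.{u}) : Type u := κ.ord.ToType

/-- The set `2^κ` of all functions from `κ` to `{0, 1}`. This is deliberately not reducible:
its topology is the bounded topology below and not the product topology. -/
def Space (κ : Cardinal.{u}) : Type u := Below κ → Bool

/-- The basic open set `N_p`, for `α < κ` and `p ∈ 2^α`. -/
def basicOpen {κ : Cardinal.{u}} (α : Below κ) (p : Set.Iio α → Bool) : Set (Space κ) :=
  {η : Space κ | ∀ γ : Set.Iio α, η γ.1 = p γ}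

/-- The topology on `2^κ` generated by the sets `N_p`. -/
instance (κ : Cardinal.{u}) : TopologicalSpace (Space κ) :=
  TopologicalSpace.generateFrom
    {U : Set (Space κ) | ∃ (α : Below κ) (p : Set.Iio α → Bool), U = basicOpen α p}

/-- Borel sets in the sense of `κ`: the closure of the open sets under complements and under unions
and intersections of length at most `κ`. -/
inductive IsBorel (κ : Cardinal.{u}) {X : Type u} [TopologicalSpace X] : Set X → Prop
  | of_open (U : Set X) (hU : IsOpen U) : IsBorel κ U
  | compl (A : Set X) (hA : IsBorel κ A) : IsBorel κ Aᶜ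
  | iUnion (ι : Type u) (hι : #ι ≤ κ) (A : ι → Set X) (hA : ∀ i, IsBorel κ (A i)) :
      IsBorel κ (⋃ i, A i)
  | iInter (ι : Type u) (hι : #ι ≤ κ) (A : ι → Set X) (hA : ∀ i, IsBorel κ (A i)) :
      IsBorel κ (⋂ i, A i)

/-- A function `2^κ → 2^κ` is Borel if inverse images of open sets are Borel. -/
def IsBorelFun {κ : Cardinal.{u}} (f : Space κ → Space κ) : Prop :=
  ∀ U : Set (Space κ), IsOpen U → IsBorel κ (f ⁻¹' U)

/-- `E` is a Borel equivalence relation on `2^κ`: an equivalence relation which is Borel as a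
subset of the product space `2^κ × 2^κ`. -/
def IsBorelEquiv {κ : Cardinal.{u}} (E : Space κ → Space κ → Prop) : Prop :=
  Equivalence E ∧ IsBorel κ {x : Space κ × Space κ | E x.1 x.2}

/-- Borel reducibility `E ≤_B E'` of relations on `2^κ`. -/
def BorelReducible {κ : Cardinal.{u}} (E E' : Space κ → Space κ → Prop) : Prop :=
  ∃ f : Space κ → Space κ, IsBorelFun f ∧ ∀ η ξ, E η ξ ↔ E' (f η) (f ξ)

/-- The set of (nonzero) limit ordinals below `κ`. -/
def limits (κ : Cardinal.{u}) : Set (Below κ) := {α | Order.IsSuccLimit α}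

/-- `C ⊆ κ` is `ω`-closed: it contains the supremum of every increasing `ω`-sequence in `C`. -/
def IsOmegaClosed {κ : Cardinal.{u}} (C : Set (Below κ)) : Prop :=
  ∀ s : ℕ → Below κ, StrictMono s → (∀ n, s n ∈ C) → ∀ α, IsLUB (Set.range s) α → α ∈ C

/-- `C ⊆ κ` is `ω`-cub: `ω`-closed and unbounded in `κ`. -/
def IsOmegaCub {κ : Cardinal.{u}} (C : Set (Below κ)) : Prop :=
  IsOmegaClosed C ∧ ¬ BddAbove C

/-- `S ⊆ κ` is `ω`-stationary: it meets every `ω`-cub set. -/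
def IsOmegaStationary {κ : Cardinal.{u}} (S : Set (Below κ)) : Prop :=
  ∀ C : Set (Below κ), IsOmegaCub C → (S ∩ C).Nonempty

/-- The relation `E₀`: equality modulo a bounded set. -/
def EZero {κ : Cardinal.{u}} (η ξ : Space κ) : Prop :=
  BddAbove {α : Below κ | η α ≠ ξ α}

/-- The relation `E*_S`: at every `α ∈ S` the symmetric difference of `η` and `ξ` is constant on
some interval `(β, α)` with `β < α`. -/
def EStar {κ : Cardinal.{u}} (S : Set (Below κ)) (η ξ : Space κ) : Prop :=
  ∀ α ∈ S, ∃ β < α, ∃ c : Bool, ∀ γ ∈ Set.Ioo β α, xor (η γ) (ξ γ) = c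

/-- The relation `E_S = E*_S ∩ E₀`. -/
def ERel {κ : Cardinal.{u}} (S : Set (Below κ)) (η ξ : Space κ) : Prop :=
  EStar S η ξ ∧ EZero η ξ

/-- `A_η = {(α, n) ∈ κ × 2 | (n = 0 ∧ η(α) = 1) ∨ (n = 1 ∧ η(α) = 0)}`. -/
def code {κ : Cardinal.{u}} (η : Space κ) : Set (Below κ × Bool) :=
  {x | (x.2 = false ∧ η x.1 = true) ∨ (x.2 = true ∧ η x.1 = false)}

/-- `S_η = ⋃_{i ∈ f[A_η]} S_i`. -/
def unionOf {κ : Cardinal.{u}} (S : Below κ → Set (Below κ)) (f : Below κ × Bool ≃ Below κ)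
    (η : Space κ) : Set (Below κ) :=
  ⋃ i ∈ f '' code η, S i

end GenCantor

/-! Everything rests on `not_borelReducible_eRel`: if `S' \ S` is `ω`-stationary, then `E_S` does
not reduce to `E_{S'}`. Given a Borel reduction `f`, the Baire property provides a comeager set `D`
on which `f` is continuous. Call a pair of conditions of equal length good if their difference is
locally constant at the points of `S` up to that length. Every good pair has a good extension which
forces, for points of `D`, that the two values of `f` agree at one large coordinate and differ at
another (`exists_extension`). Stationarity provides a point `α ∈ S' \ S` of cofinality `ω` which is
the limit of the lengths of such a chain. Since `α ∉ S`, the limit pair is still good; prolonged by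
a common generic tail it becomes an `E_S`-equivalent pair in `D`, whose values agree and differ
cofinally often below `α ∈ S'`, so they are not `E_{S'}`-equivalent.

It remains to have enough stationary sets. Fix ladders at the points of cofinality `ω`; pressing
down on a suitable ladder entry gives `κ` many disjoint `ω`-stationary fibres
(`exists_disjoint_isOmegaStationary`). The sets `A_η` are pairwise incomparable under inclusion, so
for `η ≠ ξ` the set `S_ξ \ S_η` contains one of the fibres. -/

namespace GenCantor

variable {κ : Cardinal.{u}}

/-! ### Regularity of `κ` and `ω`-cub sets -/

/-- For singular `κ`, König's inequality `κ < κ ^ cof κ` contradicts the hypothesis on powers. -/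
lemma isRegular_of_powerlt (hκ : ℵ₀ < κ) (hpow : κ ^< κ = κ) : κ.IsRegular := by
  refine ⟨hκ.le, ?_⟩
  by_contra! h
  have h1 := le_powerlt κ h
  rw [hpow] at h1
  exact absurd (lt_power_cof_ord hκ.le) (not_lt.2 h1)

lemma exists_forall_lt (hreg : κ.IsRegular) {ι : Type u} (hι : #ι < κ) (g : ι → Below κ) :
    ∃ b, ∀ i, g i < b := by
  by_contra! h
  have hc : IsCofinal (range g) := fun b => by
    obtain ⟨i, hi⟩ := h b
    exact ⟨g i, mem_range_self i, hi⟩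
  have h1 := (Order.cof_le hc).trans mk_range_le
  rw [Ordinal.cof_toType, hreg.cof_ord] at h1
  exact absurd hι (not_lt.2 h1)

lemma exists_nat_forall_lt (hreg : κ.IsRegular) (hκ : ℵ₀ < κ) (g : ℕ → Below κ) :
    ∃ b, ∀ n, g n < b := by
  obtain ⟨b, hb⟩ := exists_forall_lt hreg (ι := ULift.{u} ℕ) (by simpa using hκ)
    (fun n => g n.down)
  exact ⟨b, fun n => hb ⟨n⟩⟩

lemma mk_Iio_below_lt (a : Below κ) : #(Iio a) < κ := by
  simpa using mk_Iio_lt a (by simp)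

lemma exists_Iio_forall_lt (hreg : κ.IsRegular) (a : Below κ) (g : Below κ → Below κ) :
    ∃ b, ∀ i < a, g i < b := by
  obtain ⟨b, hb⟩ := exists_forall_lt hreg (mk_Iio_below_lt a) (fun i : Iio a => g i)
  exact ⟨b, fun i hi => hb ⟨i, hi⟩⟩

lemma exists_above (hreg : κ.IsRegular) (a : Below κ) : ∃ b, a < b := by
  obtain ⟨b, hb⟩ := exists_forall_lt hreg (ι := PUnit)
    (by simpa using one_lt_aleph0.trans_le hreg.aleph0_le) (fun _ => a)
  exact ⟨b, hb ⟨⟩⟩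

lemma nonempty_below (hreg : κ.IsRegular) : Nonempty (Below κ) := by
  rw [← mk_ne_zero_iff, mk_ord_toType]
  exact hreg.pos.ne'

/-- `α` is the supremum of the strictly increasing sequence `s`. -/
def IsLadder (α : Below κ) (s : ℕ → Below κ) : Prop := StrictMono s ∧ IsLUB (range s) α

lemma IsLadder.lt {α : Below κ} {s : ℕ → Below κ} (h : IsLadder α s) (n : ℕ) : s n < α :=
  (h.1 (Nat.lt_succ_self n)).trans_le (h.2.1 (mem_range_self _))

lemma IsLadder.exists_lt {α b : Below κ} {s : ℕ → Below κ} (h : IsLadder α s) (hb : b < α) :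
    ∃ n, b < s n := by
  obtain ⟨_, ⟨n, rfl⟩, hn⟩ := (lt_isLUB_iff h.2).1 hb
  exact ⟨n, hn⟩

lemma IsLadder.mem_limits {α : Below κ} {s : ℕ → Below κ} (h : IsLadder α s) :
    α ∈ limits κ := by
  refine ⟨not_isMin_of_lt (h.lt 0), fun b hb => ?_⟩
  obtain ⟨n, hn⟩ := h.exists_lt hb.1
  exact hb.2 hn (h.lt n)

lemma isLadder_of_forall {α : Below κ} {s : ℕ → Below κ} (hs : StrictMono s)
    (h1 : ∀ n, s n < α) (h2 : ∀ b < α, ∃ n, b < s n) : IsLadder α s := by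
  refine ⟨hs, ?_, fun b hb => ?_⟩
  · rintro _ ⟨n, rfl⟩
    exact (h1 n).le
  · by_contra! hlt
    obtain ⟨n, hn⟩ := h2 b hlt
    exact absurd (hb (mem_range_self n)) (not_le.2 hn)

/-- The points of cofinality `ω` that are closed under `h`. -/
def closurePoints (h : Below κ → Below κ → Below κ) : Set (Below κ) :=
  {α | (∃ s, IsLadder α s) ∧ ∀ i < α, ∀ j < α, h i j < α}

lemma exists_lub (s : Set (Below κ)) (h : BddAbove s) : ∃ α, IsLUB s α :=
  ⟨WellFounded.min wellFounded_lt (upperBounds s) h, WellFounded.min_mem _ _ _,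
    fun _ hb => not_lt.1 (WellFounded.not_lt_min _ _ hb)⟩

/-- Unboundedness is the usual `ω`-fold closing off: regularity bounds `h` on each initial square,
and uncountable cofinality gives the iterates a supremum. -/
lemma isOmegaCub_closurePoints (hreg : κ.IsRegular) (hκ : ℵ₀ < κ)
    (h : Below κ → Below κ → Below κ) : IsOmegaCub (closurePoints h) := by
  constructor
  · intro s hs hmem α hα
    have hl : IsLadder α s := ⟨hs, hα⟩
    refine ⟨⟨s, hl⟩, fun i hi j hj => ?_⟩
    obtain ⟨n, hn⟩ := hl.exists_lt hi
    obtain ⟨m, hm⟩ := hl.exists_lt hj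
    have := (hmem (max n m)).2 i (hn.trans_le (hs.monotone (le_max_left _ _))) j
      (hm.trans_le (hs.monotone (le_max_right _ _)))
    exact this.trans (hl.lt _)
  · rintro ⟨b, hb⟩
    have step : ∀ a : Below κ, ∃ c, a < c ∧ ∀ i < a, ∀ j < a, h i j < c := by
      intro a
      choose g hg using fun i => exists_Iio_forall_lt hreg a (h i)
      obtain ⟨d, hd⟩ := exists_Iio_forall_lt hreg a g
      obtain ⟨c, hc⟩ := exists_above hreg (max a d)
      exact ⟨c, (le_max_left _ _).trans_lt hc, fun i hi j hj =>
        ((hg i j hj).trans (hd i hi)).trans ((le_max_right _ _).trans_lt hc)⟩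
    choose F hF1 hF2 using step
    obtain ⟨b', hb'⟩ := exists_above hreg b
    let s : ℕ → Below κ := fun n => F^[n] b'
    have hsucc : ∀ n, s (n + 1) = F (s n) := fun n => Function.iterate_succ_apply' F n b'
    have hs : StrictMono s := strictMono_nat_of_lt_succ fun n => by
      rw [hsucc]; exact hF1 _
    obtain ⟨c, hc⟩ := exists_nat_forall_lt hreg hκ s
    obtain ⟨α, hα⟩ := exists_lub (range s) ⟨c, by rintro _ ⟨n, rfl⟩; exact (hc n).le⟩
    have hl : IsLadder α s := ⟨hs, hα⟩
    have hm : α ∈ closurePoints h := by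
      refine ⟨⟨s, hl⟩, fun i hi j hj => ?_⟩
      obtain ⟨n, hn⟩ := hl.exists_lt hi
      obtain ⟨m, hm⟩ := hl.exists_lt hj
      have := hF2 (s (max n m)) i (hn.trans_le (hs.monotone (le_max_left _ _))) j
        (hm.trans_le (hs.monotone (le_max_right _ _)))
      rw [← hsucc] at this
      exact this.trans (hl.lt _)
    exact absurd ((hb'.trans (hl.lt 0)).trans_le (hb hm)) (lt_irrefl _)

/-! ### Disjoint `ω`-stationary sets -/

/-- An `ω`-closed set contains every point of cofinality `ω` in which it is cofinal. -/
lemma IsOmegaClosed.mem_of_cofinal {C : Set (Below κ)} (hC : IsOmegaClosed C) {α : Below κ}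
    {s : ℕ → Below κ} (hs : IsLadder α s) (h : ∀ i < α, ∃ c ∈ C, i < c ∧ c < α) : α ∈ C := by
  have : Nonempty (Below κ) := ⟨α⟩
  choose! g hgC hg1 hg2 using h
  -- A sequence in `C` that dominates the ladder `s` and stays below `α`, hence has the same
  -- supremum.
  let t : ℕ → Below κ := fun n => Nat.rec (g (s 0)) (fun n a => g (max a (s (n + 1)))) n
  have hlt : ∀ n, t n < α := by
    intro n
    induction n with
    | zero => exact hg2 _ (hs.lt 0)
    | succ n ih => exact hg2 _ (max_lt ih (hs.lt _))
  have hst : ∀ n, s n < t n := by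
    intro n
    cases n with
    | zero => exact hg1 _ (hs.lt 0)
    | succ n => exact (le_max_right _ _).trans_lt (hg1 _ (max_lt (hlt n) (hs.lt _)))
  have htm : StrictMono t := strictMono_nat_of_lt_succ fun n =>
    (le_max_left _ _).trans_lt (hg1 _ (max_lt (hlt n) (hs.lt _)))
  have hmem : ∀ n, t n ∈ C := by
    intro n
    cases n with
    | zero => exact hgC _ (hs.lt 0)
    | succ n => exact hgC _ (max_lt (hlt n) (hs.lt _))
  refine hC t htm hmem α (isLadder_of_forall htm hlt fun b hb => ?_).2
  obtain ⟨n, hn⟩ := hs.exists_lt hb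
  exact ⟨n, hn.trans (hst n)⟩

lemma IsOmegaCub.exists_next {C : Set (Below κ)} (hC : IsOmegaCub C) (i : Below κ) :
    ∃ c ∈ C, i < c := by
  by_contra! h
  exact hC.2 ⟨i, fun c hc => h c hc⟩

lemma exists_isOmegaCub_disjoint {S : Set (Below κ)} (h : ¬ IsOmegaStationary S) :
    ∃ C, IsOmegaCub C ∧ ∀ α ∈ S, α ∉ C := by
  unfold IsOmegaStationary at h
  push Not at h
  obtain ⟨C, hC, he⟩ := h
  exact ⟨C, hC, fun α h1 h2 => (he ▸ (⟨h1, h2⟩ : α ∈ S ∩ C) : α ∈ (∅ : Set (Below κ)))⟩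

/-- Otherwise each entry `n` is bounded by some `β n` on an `ω`-cub set `C n`. A point in all the `C
n` and above a common bound of the `β n` has a ladder that passes this bound at some entry, which is
absurd. -/
lemma exists_ladder_entry (hreg : κ.IsRegular) (hκ : ℵ₀ < κ) (a : Below κ → ℕ → Below κ)
    (ha : ∀ α, (∃ s, IsLadder α s) → IsLadder α (a α)) :
    ∃ n, ∀ β, IsOmegaStationary {α | IsLadder α (a α) ∧ β ≤ a α n} := by
  by_contra! hcon
  choose β hβ using hcon
  choose C hC hdisj using fun n => exists_isOmegaCub_disjoint (hβ n)
  obtain ⟨b, hb⟩ := exists_nat_forall_lt hreg hκ β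
  choose nx hnC hnx using fun n i => (hC n).exists_next i
  choose m hm using fun j => exists_nat_forall_lt hreg hκ (fun n => nx n j)
  -- The constant `b` forces `b < α`; the function `m` makes every `C n` cofinal in `α`.
  obtain ⟨α, hα⟩ : (closurePoints fun i _ => max b (m i)).Nonempty := by
    by_contra hemp
    have := (isOmegaCub_closurePoints hreg hκ fun i _ => max b (m i)).2
    have hne := nonempty_below hreg
    rw [not_nonempty_iff_eq_empty.1 hemp] at this
    exact this bddAbove_empty
  obtain ⟨hs, hcl⟩ := hα
  have hl := ha α hs
  have hcl' := fun i hi => hcl i hi i hi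
  obtain ⟨n, hn⟩ := hl.exists_lt ((le_max_left _ _).trans_lt (hcl' _ (hl.lt 0)))
  refine hdisj n α ⟨hl, ((hb n).trans hn).le⟩ ((hC n).1.mem_of_cofinal hl fun i hi => ?_)
  exact ⟨nx n i, hnC n i, hnx n i, (hm i n).trans ((le_max_right _ _).trans_lt (hcl' i hi))⟩

/-- There are `κ` many pairwise disjoint `ω`-stationary sets of limits. -/
theorem exists_disjoint_isOmegaStationary (hreg : κ.IsRegular) (hκ : ℵ₀ < κ) :
    ∃ S : Below κ → Set (Below κ), (∀ i, S i ⊆ limits κ) ∧ (∀ i, IsOmegaStationary (S i)) ∧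
      ∀ i j, i ≠ j → Disjoint (S i) (S j) := by
  have := nonempty_below hreg
  obtain ⟨a, ha⟩ : ∃ a : Below κ → ℕ → Below κ,
      ∀ α, (∃ s, IsLadder α s) → IsLadder α (a α) := by
    choose! a ha using fun α : Below κ => fun h : ∃ s, IsLadder α s => h
    exact ⟨a, ha⟩
  obtain ⟨n, hn⟩ := exists_ladder_entry hreg hκ a ha
  let G : Set (Below κ) := {γ | IsOmegaStationary {α | IsLadder α (a α) ∧ a α n = γ}}
  have hG : ∀ β, ∃ γ ∈ G, β ≤ γ := by
    intro β
    by_contra! hcon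
    have hCex : ∀ γ, ∃ C, IsOmegaCub C ∧
        (β ≤ γ → ∀ α ∈ {α | IsLadder α (a α) ∧ a α n = γ}, α ∉ C) := by
      intro γ
      by_cases hγ : β ≤ γ
      · obtain ⟨C, hC, hd⟩ := exists_isOmegaCub_disjoint fun h => absurd hγ (not_le.2 (hcon γ h))
        exact ⟨C, hC, fun _ => hd⟩
      -- For `γ < β` any `ω`-cub set serves.
      · exact ⟨_, isOmegaCub_closurePoints hreg hκ fun i _ => i, fun h => absurd h hγ⟩
    choose C hC hd using hCex
    choose nx hnC hnx using fun γ i => (hC γ).exists_next i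
    -- Closure under the binary function `nx` is a diagonal intersection: `α` lies in `C γ` for all
    -- `γ < α`, in particular for `γ = a α n`. This replaces Fodor's lemma.
    obtain ⟨α, ⟨hl, hβ⟩, -, hcl⟩ := hn β _ (isOmegaCub_closurePoints hreg hκ nx)
    refine hd (a α n) hβ α ⟨hl, rfl⟩ ((hC _).1.mem_of_cofinal hl fun i hi => ?_)
    exact ⟨nx (a α n) i, hnC _ _, hnx _ _, hcl _ (hl.lt n) _ hi⟩
  have hcard : #(Below κ) ≤ #G := by
    rw [mk_ord_toType]
    by_contra! hlt
    obtain ⟨b, hb⟩ := exists_forall_lt hreg hlt (fun γ : G => γ.1)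
    obtain ⟨γ, hγ, hbγ⟩ := hG b
    exact absurd (hb ⟨γ, hγ⟩) (not_lt.2 hbγ)
  obtain ⟨e⟩ := Cardinal.le_def .. |>.1 hcard
  refine ⟨fun i => {α | IsLadder α (a α) ∧ a α n = e i}, fun i α h => h.1.mem_limits,
    fun i => (e i).2, fun i j hij => Set.disjoint_left.2 fun α h1 h2 => hij ?_⟩
  exact e.injective (Subtype.ext (h1.2.symm.trans h2.2))

/-! ### Baire category on `2^κ` -/

/-- `x` and `y` agree below `α`. -/
def AgreeBelow (α : Below κ) (x y : Space κ) : Prop := ∀ γ < α, x γ = y γ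

lemma AgreeBelow.symm {α : Below κ} {x y : Space κ} (h : AgreeBelow α x y) : AgreeBelow α y x :=
  fun γ hγ => (h γ hγ).symm

lemma AgreeBelow.trans {α : Below κ} {x y z : Space κ} (h : AgreeBelow α x y)
    (h' : AgreeBelow α y z) : AgreeBelow α x z :=
  fun γ hγ => (h γ hγ).trans (h' γ hγ)

lemma AgreeBelow.mono {α β : Below κ} {x y : Space κ} (h : AgreeBelow α x y) (hβ : β ≤ α) :
    AgreeBelow β x y :=
  fun γ hγ => h γ (hγ.trans_le hβ)

lemma AgreeBelow.refl (α : Below κ) (x : Space κ) : AgreeBelow α x x := fun _ _ => rfl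

lemma isOpen_iff_agreeBelow (hreg : κ.IsRegular) {U : Set (Space κ)} :
    IsOpen U ↔ ∀ x ∈ U, ∃ α, ∀ y, AgreeBelow α x y → y ∈ U := by
  have := nonempty_below hreg
  constructor
  · intro hU
    induction hU with
    | basic s hs =>
      obtain ⟨α, p, rfl⟩ := hs
      exact fun x hx => ⟨α, fun y hy γ => (hy γ.1 γ.2).symm.trans (hx γ)⟩
    | univ => exact fun x _ => ⟨Classical.arbitrary _, fun _ _ => trivial⟩
    | inter s t _ _ hs ht =>
      intro x hx
      obtain ⟨α, hα⟩ := hs x hx.1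
      obtain ⟨β, hβ⟩ := ht x hx.2
      exact ⟨max α β, fun y hy =>
        ⟨hα y (hy.mono (le_max_left _ _)), hβ y (hy.mono (le_max_right _ _))⟩⟩
    | sUnion T _ ih =>
      rintro x ⟨s, hs, hx⟩
      obtain ⟨α, hα⟩ := ih s hs x hx
      exact ⟨α, fun y hy => ⟨s, hs, hα y hy⟩⟩
  · intro h
    choose! α hα using h
    have : U = ⋃ x ∈ U, basicOpen (α x) (fun γ => x γ.1) := by
      ext y
      simp only [mem_iUnion]
      constructor
      · exact fun hy => ⟨y, hy, fun _ => rfl⟩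
      · rintro ⟨x, hx, hy⟩
        exact hα x hx y fun γ hγ => (hy ⟨γ, hγ⟩).symm
    rw [this]
    exact isOpen_biUnion fun x _ => TopologicalSpace.isOpen_generateFrom_of_mem ⟨_, _, rfl⟩

lemma isOpen_setOf_agreeBelow (hreg : κ.IsRegular) (α : Below κ) (x : Space κ) :
    IsOpen {y | AgreeBelow α x y} :=
  (isOpen_iff_agreeBelow hreg).2 fun _ hy => ⟨α, fun _ hz => hy.trans hz⟩

lemma dense_iff_agreeBelow (hreg : κ.IsRegular) {A : Set (Space κ)} :
    Dense A ↔ ∀ x α, ∃ y ∈ A, AgreeBelow α x y := by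
  constructor
  · intro h x α
    obtain ⟨y, hy, hA⟩ := h.inter_open_nonempty _ (isOpen_setOf_agreeBelow hreg α x)
      ⟨x, AgreeBelow.refl α x⟩
    exact ⟨y, hA, hy⟩
  · intro h
    rw [dense_iff_inter_open]
    rintro U hU ⟨x, hx⟩
    obtain ⟨α, hα⟩ := (isOpen_iff_agreeBelow hreg).1 hU x hx
    obtain ⟨y, hy, hxy⟩ := h x α
    exact ⟨y, hα y hxy, hy⟩

/-- A common extension of a family of conditions, with values of `d` where none is defined. -/
noncomputable def glue {ι : Type*} (d : Space κ) (c : ι → Space κ × Below κ) : Space κ := by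
  classical
  exact fun γ => if h : ∃ j, γ < (c j).2 then (c h.choose).1 γ else d γ

lemma agreeBelow_glue {ι : Type*} (d : Space κ) (c : ι → Space κ × Below κ)
    (h : ∀ i j, AgreeBelow (min (c i).2 (c j).2) (c i).1 (c j).1) (i : ι) :
    AgreeBelow (c i).2 (c i).1 (glue d c) := by
  intro γ hγ
  have hex : ∃ j, γ < (c j).2 := ⟨i, hγ⟩
  have : glue d c γ = (c hex.choose).1 γ := dif_pos hex
  rw [this]
  exact h _ _ γ (lt_min hγ hex.choose_spec)

/-- The intersection of `κ` many dense open sets is dense. -/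
theorem exists_mem_iInter_agreeBelow (hreg : κ.IsRegular) (D : Below κ → Set (Space κ))
    (ho : ∀ i, IsOpen (D i)) (hd : ∀ i, Dense (D i)) (x : Space κ) (α : Below κ) :
    ∃ y, (∀ i, y ∈ D i) ∧ AgreeBelow α x y := by
  have hext : ∀ (i : Below κ) (z : Space κ) (β : Below κ), ∃ p : Space κ × Below κ,
      β ≤ p.2 ∧ AgreeBelow β z p.1 ∧ ∀ y, AgreeBelow p.2 p.1 y → y ∈ D i := by
    intro i z β
    obtain ⟨w, hw, hzw⟩ := (dense_iff_agreeBelow hreg).1 (hd i) z β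
    obtain ⟨δ, hδ⟩ := (isOpen_iff_agreeBelow hreg).1 (ho i) w hw
    exact ⟨(w, max β δ), le_max_left _ _, hzw, fun y hy => hδ y (hy.mono (le_max_right _ _))⟩
  choose E hE1 hE2 hE3 using hext
  have hbd : ∀ (i : Below κ) (g : Iio i → Below κ), ∃ b, α ≤ b ∧ ∀ j, g j ≤ b := by
    intro i g
    obtain ⟨b, hb⟩ := exists_forall_lt hreg (mk_Iio_below_lt i) g
    exact ⟨max α b, le_max_left _ _, fun j => (hb j).le.trans (le_max_right _ _)⟩
  choose B hB1 hB2 using hbd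
  -- Stage `i` glues the earlier conditions, passes to a bound of their lengths (and of `α`), and
  -- extends into `D i`.
  let next : (i : Below κ) → (Iio i → Space κ × Below κ) → Space κ × Below κ := fun i c =>
    E i (glue x c) (B i fun j => (c j).2)
  let c : Below κ → Space κ × Below κ :=
    WellFounded.fix (wellFounded_lt (α := Below κ)) fun i rec => next i fun j => rec j.1 j.2
  have hc : ∀ i, c i = next i fun j => c j.1 := fun i => WellFounded.fix_eq _ _ _
  have hle : ∀ i, α ≤ (c i).2 ∧ ∀ j < i, (c j).2 ≤ (c i).2 := by
    intro i
    have hB := hE1 i (glue x fun j : Iio i => c j.1) (B i fun j => (c j.1).2)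
    have : (B i fun j => (c j.1).2) ≤ (c i).2 := by rw [hc i]; exact hB
    exact ⟨(hB1 _ _).trans this, fun j hj => (hB2 i (fun j => (c j.1).2) ⟨j, hj⟩).trans this⟩
  have hag : ∀ i, ∀ j < i, AgreeBelow (c j).2 (c j).1 (c i).1 := by
    intro i
    induction i using WellFoundedLT.induction with
    | ind i ih =>
      intro j hj
      have hco : ∀ k l : Iio i, AgreeBelow (min (c k.1).2 (c l.1).2) (c k.1).1 (c l.1).1 := by
        intro k l
        rcases lt_trichotomy k.1 l.1 with h | h | h
        · exact (ih _ l.2 _ h).mono (min_le_left _ _)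
        · rw [h]; exact AgreeBelow.refl _ _
        · exact (ih _ k.2 _ h).symm.mono (min_le_right _ _)
      have h1 := agreeBelow_glue x (fun j : Iio i => c j.1) hco ⟨j, hj⟩
      have h2 := hE2 i (glue x fun j : Iio i => c j.1) (B i fun j => (c j.1).2)
      have h3 := h1.trans (h2.mono (hB2 i (fun j => (c j.1).2) ⟨j, hj⟩))
      rw [hc i]
      exact h3
  have hco : ∀ k l, AgreeBelow (min (c k).2 (c l).2) (c k).1 (c l).1 := by
    intro k l
    rcases lt_trichotomy k l with h | h | h
    · exact (hag _ _ h).mono (min_le_left _ _)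
    · rw [h]; exact AgreeBelow.refl _ _
    · exact (hag _ _ h).symm.mono (min_le_right _ _)
  have hy := agreeBelow_glue x c hco
  refine ⟨glue x c, fun i => ?_, ?_⟩
  · have := hE3 i (glue x fun j : Iio i => c j.1) (B i fun j => (c j.1).2) (glue x c)
    apply this
    have h := hy i
    rw [hc i] at h
    exact h
  · have := nonempty_below hreg
    -- At the least stage the glued family is empty, so the default `x` is what gets extended; this
    -- keeps `x` below `α`.
    let i : Below κ := WellFounded.min wellFounded_lt univ univ_nonempty
    have hmin : ∀ j, ¬ j < i := fun j => WellFounded.not_lt_min _ _ (mem_univ j)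
    have h0 : glue x (fun j : Iio i => c j.1) = x := by
      funext γ
      exact dif_neg fun ⟨j, _⟩ => hmin j.1 j.2
    have h2 := hE2 i (glue x fun j : Iio i => c j.1) (B i fun j => (c j.1).2)
    rw [h0] at h2
    have h3 : AgreeBelow α x (c i).1 := by
      have := h2.mono (hB1 i fun j => (c j.1).2)
      rw [hc i]
      change AgreeBelow α x (E i (glue x fun j : Iio i => c j.1) _).1
      rw [h0]; exact this
    exact h3.trans ((hy i).mono (hle i).1)

/-- A set is `κ`-comeager if it contains an intersection of `κ` many dense open sets. -/
def IsComeager (A : Set (Space κ)) : Prop :=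
  ∃ D : Below κ → Set (Space κ), (∀ i, IsOpen (D i)) ∧ (∀ i, Dense (D i)) ∧ ⋂ i, D i ⊆ A

lemma IsComeager.exists_agreeBelow (hreg : κ.IsRegular) {A : Set (Space κ)} (hA : IsComeager A)
    (x : Space κ) (α : Below κ) : ∃ y ∈ A, AgreeBelow α x y := by
  obtain ⟨D, ho, hd, hs⟩ := hA
  obtain ⟨y, hy, hxy⟩ := exists_mem_iInter_agreeBelow hreg D ho hd x α
  exact ⟨y, hs (mem_iInter.2 hy), hxy⟩

lemma isComeager_iInter (hreg : κ.IsRegular) {ι : Type u} (hι : #ι ≤ κ) {A : ι → Set (Space κ)}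
    (hA : ∀ i, IsComeager (A i)) : IsComeager (⋂ i, A i) := by
  choose D ho hd hs using hA
  by_cases hne : Nonempty ι
  · have := nonempty_below hreg
    obtain ⟨e⟩ : Nonempty (ι × Below κ ↪ Below κ) := by
      rw [← Cardinal.le_def, mk_prod, lift_id, lift_id, mk_ord_toType]
      exact (mul_le_mul_left hι κ).trans (mul_eq_self hreg.aleph0_le).le
    have hsurj := Function.invFun_surjective e.injective
    refine ⟨fun i => D (Function.invFun e i).1 (Function.invFun e i).2, fun i => ho _ _,
      fun i => hd _ _, fun x hx => mem_iInter.2 fun i => hs i (mem_iInter.2 fun j => ?_)⟩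
    obtain ⟨k, hk⟩ := hsurj (i, j)
    have := mem_iInter.1 hx k
    simp only [hk] at this
    exact this
  · refine ⟨fun _ => univ, fun _ => isOpen_univ, fun _ => dense_univ, fun x _ => ?_⟩
    exact mem_iInter.2 fun i => (hne ⟨i⟩).elim

lemma IsComeager.inter (hreg : κ.IsRegular) {A B : Set (Space κ)} (hA : IsComeager A)
    (hB : IsComeager B) : IsComeager (A ∩ B) := by
  have h := isComeager_iInter hreg (ι := ULift.{u} Bool)
    (by simpa using (natCast_lt_aleph0 (n := 2)).le.trans hreg.aleph0_le)
    (A := fun b => bif b.down then A else B) (by rintro ⟨_ | _⟩ <;> assumption)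
  obtain ⟨D, ho, hd, hs⟩ := h
  refine ⟨D, ho, hd, fun x hx => ?_⟩
  have := mem_iInter.1 (hs hx)
  exact ⟨this ⟨true⟩, this ⟨false⟩⟩

lemma isComeager_of_isOpen_dense {A : Set (Space κ)} (ho : IsOpen A) (hd : Dense A)
    (hreg : κ.IsRegular) : IsComeager A := by
  have := nonempty_below hreg
  exact ⟨fun _ => A, fun _ => ho, fun _ => hd, fun x hx => mem_iInter.1 hx (Classical.arbitrary _)⟩

/-! ### Baire property and generic continuity -/

/-- Borel sets have the Baire property. -/
theorem IsBorel.exists_isOpen (hreg : κ.IsRegular) {A : Set (Space κ)} (hA : IsBorel κ A) :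
    ∃ U D, IsOpen U ∧ IsComeager D ∧ ∀ x ∈ D, (x ∈ A ↔ x ∈ U) := by
  have hcompl : ∀ A : Set (Space κ),
      (∃ U D, IsOpen U ∧ IsComeager D ∧ ∀ x ∈ D, (x ∈ A ↔ x ∈ U)) →
      ∃ U D, IsOpen U ∧ IsComeager D ∧ ∀ x ∈ D, (x ∈ Aᶜ ↔ x ∈ U) := by
    rintro A ⟨U, D, hU, hD, h⟩
    -- The boundary of an open set is nowhere dense.
    have hdense : Dense (U ∪ interior Uᶜ) := by
      rw [interior_compl, dense_iff_closure_eq, closure_union]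
      refine eq_univ_of_forall fun x => ?_
      by_cases hx : x ∈ closure U
      · exact Or.inl hx
      · exact Or.inr (subset_closure hx)
    refine ⟨interior Uᶜ, D ∩ (U ∪ interior Uᶜ), isOpen_interior, hD.inter hreg
      (isComeager_of_isOpen_dense (hU.union isOpen_interior) hdense hreg), fun x hx => ?_⟩
    rw [mem_compl_iff, h x hx.1]
    exact ⟨fun hn => hx.2.resolve_left hn, fun hi => interior_subset hi⟩
  have hunion : ∀ (ι : Type u) (_ : #ι ≤ κ) (A : ι → Set (Space κ)),
      (∀ i, ∃ U D, IsOpen U ∧ IsComeager D ∧ ∀ x ∈ D, (x ∈ A i ↔ x ∈ U)) →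
      ∃ U D, IsOpen U ∧ IsComeager D ∧ ∀ x ∈ D, (x ∈ ⋃ i, A i ↔ x ∈ U) := by
    intro ι hι A ih
    choose U D hU hD h using ih
    refine ⟨⋃ i, U i, ⋂ i, D i, isOpen_iUnion hU, isComeager_iInter hreg hι hD, fun x hx => ?_⟩
    simp only [mem_iUnion]
    exact exists_congr fun i => h i x (mem_iInter.1 hx i)
  induction hA with
  | of_open U hU =>
    exact ⟨U, univ, hU, isComeager_of_isOpen_dense isOpen_univ dense_univ hreg, fun _ _ => Iff.rfl⟩
  | compl A _ ih => exact hcompl A ih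
  | iUnion ι hι A _ ih => exact hunion ι hι A ih
  | iInter ι hι A _ ih =>
    have := hcompl _ (hunion ι hι (fun i => (A i)ᶜ) fun i => hcompl _ (ih i))
    rwa [compl_iUnion, funext fun i => compl_compl (A i)] at this

lemma isOpen_setOf_apply_eq (hreg : κ.IsRegular) (ε : Below κ) (b : Bool) :
    IsOpen {x : Space κ | x ε = b} := by
  refine (isOpen_iff_agreeBelow hreg).2 fun x hx => ?_
  obtain ⟨δ, hδ⟩ := exists_above hreg ε
  exact ⟨δ, fun y hy => (hy ε hδ).symm.trans hx⟩

/-- A Borel function is continuous on a `κ`-comeager set, which is expressed by the fact that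
each initial segment of the value is decided by an initial segment of the argument. -/
theorem IsBorelFun.exists_isComeager (hreg : κ.IsRegular) {f : Space κ → Space κ}
    (hf : IsBorelFun f) : ∃ D, IsComeager D ∧
      ∀ x ∈ D, ∀ γ, ∃ δ, ∀ y ∈ D, AgreeBelow δ x y → AgreeBelow γ (f x) (f y) := by
  have hU := fun (b : Bool) (ε : Below κ) =>
    (hf _ (isOpen_setOf_apply_eq hreg ε b)).exists_isOpen hreg
  choose U D hU hD h using hU
  refine ⟨(⋂ ε, D true ε) ∩ ⋂ ε, D false ε,
    (isComeager_iInter hreg (mk_ord_toType κ).le (hD true)).inter hreg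
      (isComeager_iInter hreg (mk_ord_toType κ).le (hD false)), fun x hx γ => ?_⟩
  have hmem : ∀ y ∈ (⋂ ε, D true ε) ∩ ⋂ ε, D false ε, ∀ b ε, (f y ε = b ↔ y ∈ U b ε) := by
    intro y hy b ε
    cases b
    · exact h false ε y (mem_iInter.1 hy.2 ε)
    · exact h true ε y (mem_iInter.1 hy.1 ε)
  have hδ : ∀ ε, ∃ δ, ∀ y ∈ (⋂ ε, D true ε) ∩ ⋂ ε, D false ε,
      AgreeBelow δ x y → f x ε = f y ε := by
    intro ε
    obtain ⟨δ, hδ⟩ := (isOpen_iff_agreeBelow hreg).1 (hU (f x ε) ε) x ((hmem x hx _ ε).1 rfl)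
    exact ⟨δ, fun y hy hxy => ((hmem y hy _ ε).2 (hδ y hxy)).symm⟩
  choose δ hδ using hδ
  obtain ⟨b, hb⟩ := exists_Iio_forall_lt hreg γ δ
  exact ⟨b, fun y hy hxy ε hε => hδ ε y hy (hxy.mono (hb ε hε).le)⟩

/-- Translation by `s` in the group `2^κ`. -/
def translate (s x : Space κ) : Space κ := fun γ => xor (x γ) (s γ)

lemma translate_translate (s x : Space κ) : translate s (translate s x) = x := by
  funext γ
  simp [translate]

lemma AgreeBelow.translate {α : Below κ} {x y : Space κ} (h : AgreeBelow α x y) (s : Space κ) :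
    AgreeBelow α (translate s x) (translate s y) :=
  fun γ hγ => by simp [GenCantor.translate, h γ hγ]

/-- Translation is an involution preserving agreement of initial segments. Thus one generic point
can be chosen together with its translate in `D`. -/
lemma IsComeager.preimage_translate (hreg : κ.IsRegular) {A : Set (Space κ)} (hA : IsComeager A)
    (s : Space κ) : IsComeager (translate s ⁻¹' A) := by
  obtain ⟨D, ho, hd, hs⟩ := hA
  refine ⟨fun i => translate s ⁻¹' D i, fun i => (isOpen_iff_agreeBelow hreg).2 fun x hx => ?_,
    fun i => (dense_iff_agreeBelow hreg).2 fun x α => ?_, fun x hx => ?_⟩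
  · obtain ⟨α, hα⟩ := (isOpen_iff_agreeBelow hreg).1 (ho i) _ hx
    exact ⟨α, fun y hy => hα _ (hy.translate s)⟩
  · obtain ⟨y, hy, hxy⟩ := (dense_iff_agreeBelow hreg).1 (hd i) (translate s x) α
    refine ⟨translate s y, ?_, ?_⟩
    · rwa [mem_preimage, translate_translate]
    · simpa only [translate_translate] using hxy.translate s
  · exact hs (mem_iInter.2 fun i => mem_iInter.1 hx i)

/-! ### The relations `E_S` -/

lemma EStar.refl {S : Set (Below κ)} (hS : S ⊆ limits κ) (x : Space κ) : EStar S x x := by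
  intro α hα
  obtain ⟨β, hβ⟩ := not_isMin_iff.1 (hS hα).1
  exact ⟨β, hβ, false, fun γ _ => by simp⟩

lemma EStar.symm {S : Set (Below κ)} {x y : Space κ} (h : EStar S x y) : EStar S y x := by
  intro α hα
  obtain ⟨β, hβ, c, hc⟩ := h α hα
  exact ⟨β, hβ, c, fun γ hγ => by rw [Bool.xor_comm]; exact hc γ hγ⟩

lemma EStar.trans {S : Set (Below κ)} {x y z : Space κ} (h : EStar S x y) (h' : EStar S y z) :
    EStar S x z := by
  intro α hα
  obtain ⟨β, hβ, c, hc⟩ := h α hα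
  obtain ⟨β', hβ', c', hc'⟩ := h' α hα
  refine ⟨max β β', max_lt hβ hβ', xor c c', fun γ hγ => ?_⟩
  have h1 := hc γ ⟨(le_max_left _ _).trans_lt hγ.1, hγ.2⟩
  have h2 := hc' γ ⟨(le_max_right _ _).trans_lt hγ.1, hγ.2⟩
  rw [← h1, ← h2]
  cases x γ <;> cases y γ <;> cases z γ <;> rfl

lemma equivalence_eZero (hreg : κ.IsRegular) : Equivalence (EZero (κ := κ)) where
  refl x := by
    have := nonempty_below hreg
    simp [EZero]
  symm h := by simpa only [EZero, ne_comm] using h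
  trans h h' := (h.union h').mono fun α hα => by
    by_contra hn
    simp only [mem_union, mem_ofPred_eq, not_or, not_not] at hn
    exact hα (hn.1.trans hn.2)

lemma equivalence_eRel (hreg : κ.IsRegular) {S : Set (Below κ)} (hS : S ⊆ limits κ) :
    Equivalence (ERel S) where
  refl x := ⟨EStar.refl hS x, (equivalence_eZero hreg).refl x⟩
  symm h := ⟨h.1.symm, (equivalence_eZero hreg).symm h.2⟩
  trans h h' := ⟨h.1.trans h'.1, (equivalence_eZero hreg).trans h.2 h'.2⟩

lemma isBorel_union (hreg : κ.IsRegular) {X : Type u} [TopologicalSpace X] {A B : Set X}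
    (hA : IsBorel κ A) (hB : IsBorel κ B) : IsBorel κ (A ∪ B) := by
  have h := IsBorel.iUnion (ULift.{u} Bool)
    (by simpa using (natCast_lt_aleph0 (n := 2)).le.trans hreg.aleph0_le)
    (fun b => bif b.down then A else B) (by rintro ⟨_ | _⟩ <;> assumption)
  convert h using 1
  ext x
  simp [ULift.exists, or_comm]

lemma isBorel_inter (hreg : κ.IsRegular) {X : Type u} [TopologicalSpace X] {A B : Set X}
    (hA : IsBorel κ A) (hB : IsBorel κ B) : IsBorel κ (A ∩ B) := by
  have := (isBorel_union hreg hA.compl hB.compl).compl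
  rwa [compl_union, compl_compl, compl_compl] at this

lemma isOpen_setOf_xor_eq (hreg : κ.IsRegular) (γ : Below κ) (c : Bool) :
    IsOpen {p : Space κ × Space κ | xor (p.1 γ) (p.2 γ) = c} := by
  have : {p : Space κ × Space κ | xor (p.1 γ) (p.2 γ) = c} =
      ⋃ b : Bool, {x : Space κ | x γ = b} ×ˢ {y : Space κ | y γ = xor b c} := by
    ext ⟨x, y⟩
    simp only [mem_ofPred_eq, mem_iUnion, mem_prod]
    cases x γ <;> cases y γ <;> cases c <;> simp
  rw [this]
  exact isOpen_iUnion fun b =>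
    (isOpen_setOf_apply_eq hreg γ b).prod (isOpen_setOf_apply_eq hreg γ _)

lemma mk_subtype_below_le (p : Below κ → Prop) : #{α // p α} ≤ κ :=
  (mk_subtype_le p).trans (mk_ord_toType κ).le

lemma isBorel_setOf_forall_xor_eq (hreg : κ.IsRegular) (I : Set (Below κ)) (c : Bool) :
    IsBorel κ {p : Space κ × Space κ | ∀ γ ∈ I, xor (p.1 γ) (p.2 γ) = c} := by
  have h := IsBorel.iInter I (mk_subtype_below_le _) _ fun γ =>
    IsBorel.of_open (κ := κ) _ (isOpen_setOf_xor_eq hreg γ.1 c)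
  convert h using 1
  ext p
  simp

lemma isBorel_eStar (hreg : κ.IsRegular) (S : Set (Below κ)) :
    IsBorel κ {p : Space κ × Space κ | EStar S p.1 p.2} := by
  have h := IsBorel.iInter S (mk_subtype_below_le _) _ fun α =>
    IsBorel.iUnion (Iio α.1) (mk_subtype_below_le _) _ fun β =>
      isBorel_union hreg (isBorel_setOf_forall_xor_eq hreg (Ioo β.1 α.1) false)
        (isBorel_setOf_forall_xor_eq hreg (Ioo β.1 α.1) true)
  convert h using 1
  ext p
  simp [EStar]

lemma isBorel_eZero (hreg : κ.IsRegular) :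
    IsBorel κ {p : Space κ × Space κ | EZero p.1 p.2} := by
  have h := IsBorel.iUnion (Below κ) (mk_ord_toType κ).le _ fun β =>
    isBorel_setOf_forall_xor_eq hreg (Ioi β) false
  convert h using 1
  ext p
  simp only [EZero, BddAbove, upperBounds, Set.Nonempty, mem_ofPred_eq, mem_iUnion, mem_Ioi]
  exact exists_congr fun β => forall_congr' fun γ => by
    rw [← not_le, ← not_imp_not, not_not]
    cases p.1 γ <;> cases p.2 γ <;> simp

theorem isBorelEquiv_eRel (hreg : κ.IsRegular) {S : Set (Below κ)} (hS : S ⊆ limits κ) :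
    IsBorelEquiv (ERel S) :=
  ⟨equivalence_eRel hreg hS, isBorel_inter hreg (isBorel_eStar hreg S) (isBorel_eZero hreg)⟩

lemma borelReducible_refl (E : Space κ → Space κ → Prop) : BorelReducible E E :=
  ⟨id, fun U hU => IsBorel.of_open U hU, fun _ _ => Iff.rfl⟩

/-! ### Pairs of conditions with locally constant difference -/

/-- The difference of `x` and `y` is constant on a final segment of `δ`. -/
def LocallyConstAt (δ : Below κ) (x y : Space κ) : Prop :=
  ∃ β < δ, ∃ c : Bool, ∀ γ ∈ Ioo β δ, xor (x γ) (y γ) = c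

lemma LocallyConstAt.congr {δ : Below κ} {x y x' y' : Space κ} (h : LocallyConstAt δ x y)
    (hx : AgreeBelow δ x x') (hy : AgreeBelow δ y y') : LocallyConstAt δ x' y' := by
  obtain ⟨β, hβ, c, hc⟩ := h
  exact ⟨β, hβ, c, fun γ hγ => by rw [← hx γ hγ.2, ← hy γ hγ.2]; exact hc γ hγ⟩

/-- The difference of `x` and `y` is locally constant at the points of `S` up to `α`. -/
def EStarUpTo (S : Set (Below κ)) (α : Below κ) (x y : Space κ) : Prop :=
  ∀ δ ∈ S, δ ≤ α → LocallyConstAt δ x y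

lemma EStarUpTo.congr {S : Set (Below κ)} {α : Below κ} {x y x' y' : Space κ}
    (h : EStarUpTo S α x y) (hx : AgreeBelow α x x') (hy : AgreeBelow α y y') :
    EStarUpTo S α x' y' :=
  fun δ hδ hle => (h δ hδ hle).congr (hx.mono hle) (hy.mono hle)

lemma EStarUpTo.eStar {S : Set (Below κ)} {α : Below κ} {x y : Space κ}
    (h : EStarUpTo S α x y) (hxy : ∀ γ, α ≤ γ → x γ = y γ) : EStar S x y := by
  intro δ hδ
  rcases le_or_gt δ α with hle | hlt
  · exact h δ hδ hle
  · exact ⟨α, hlt, false, fun γ hγ => by simp [hxy γ hγ.1.le]⟩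

lemma EStarUpTo.eRel {S : Set (Below κ)} {α : Below κ} {x y : Space κ}
    (h : EStarUpTo S α x y) (hxy : ∀ γ, α ≤ γ → x γ = y γ) : ERel S x y :=
  ⟨h.eStar hxy, α, fun γ hγ => by
    by_contra hn
    exact hγ (hxy γ (not_le.1 hn).le)⟩

/-- The difference of `x` and `y` below `α`. -/
noncomputable def diffBelow (α : Below κ) (x y : Space κ) : Space κ := by
  classical
  exact fun γ => if γ < α then xor (x γ) (y γ) else false

/-- This moves a point extending `x` to one extending `y` with the same tail. -/
lemma agreeBelow_translate_diffBelow {α : Below κ} {x u : Space κ} (y : Space κ)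
    (h : AgreeBelow α x u) : AgreeBelow α y (translate (diffBelow α x y) u) := by
  intro γ hγ
  simp only [translate, diffBelow, hγ, if_true, ← h γ hγ]
  cases x γ <;> cases y γ <;> rfl

lemma translate_diffBelow_of_le {α γ : Below κ} (x y u : Space κ) (h : α ≤ γ) :
    translate (diffBelow α x y) u γ = u γ := by
  simp [translate, diffBelow, not_lt.2 h]

/-- The initial segments of the values of `f` on `D` are decided by those of the arguments. -/
def DecidedOn (D : Set (Space κ)) (f : Space κ → Space κ) : Prop :=
  ∀ x ∈ D, ∀ γ, ∃ δ, ∀ y ∈ D, AgreeBelow δ x y → AgreeBelow γ (f x) (f y)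

section Reduction

variable {S S' : Set (Below κ)} {f : Space κ → Space κ} {D : Set (Space κ)}

/-- A common generic tail makes the pair `E_S`-equivalent, so the values of `f` agree from some
point on; continuity on `D` lets conditions decide one such agreement. -/
lemma exists_extension_eq (hreg : κ.IsRegular) (hD : IsComeager D) (hdec : DecidedOn D f)
    (hred : ∀ η ξ, ERel S η ξ → ERel S' (f η) (f ξ)) {x y : Space κ} {α : Below κ}
    (hxy : EStarUpTo S α x y) (γ : Below κ) :
    ∃ x' y' α' ε, γ < α' ∧ α ≤ α' ∧ AgreeBelow α x x' ∧ AgreeBelow α y y' ∧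
      EStarUpTo S α' x' y' ∧ γ < ε ∧
      ∀ u ∈ D, ∀ v ∈ D, AgreeBelow α' x' u → AgreeBelow α' y' v → f u ε = f v ε := by
  obtain ⟨u, ⟨hu, hv⟩, hxu⟩ := (hD.inter hreg
    (hD.preimage_translate hreg (diffBelow α x y))).exists_agreeBelow hreg x α
  set v := translate (diffBelow α x y) u with hvdef
  have hyv : AgreeBelow α y v := agreeBelow_translate_diffBelow y hxu
  have huv : ERel S u v := (hxy.congr hxu hyv).eRel fun γ hγ =>
    (translate_diffBelow_of_le x y u hγ).symm
  obtain ⟨b, hb⟩ := (hred u v huv).2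
  obtain ⟨ε, hε⟩ := exists_above hreg (max b γ)
  obtain ⟨ε', hε'⟩ := exists_above hreg ε
  obtain ⟨δ₁, hδ₁⟩ := hdec u hu ε'
  obtain ⟨δ₂, hδ₂⟩ := hdec v hv ε'
  obtain ⟨α', hα'⟩ := exists_above hreg (max (max γ α) (max δ₁ δ₂))
  simp only [max_lt_iff] at hα' hε
  refine ⟨u, v, α', ε, hα'.1.1, hα'.1.2.le, hxu, hyv, fun δ hδ _ => huv.1 δ hδ, hε.2, ?_⟩
  intro u' hu' v' hv' huu' hvv'
  rw [← hδ₁ u' hu' (huu'.mono hα'.2.1.le) ε hε', ← hδ₂ v' hv' (hvv'.mono hα'.2.2.le) ε hε']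
  by_contra hne
  exact absurd (hb hne) (not_le.2 hε.1)

/-- Otherwise, by continuity, `f u` and `f v` agree beyond `γ` for all `E*_S`-related `u`, `v` in
`D` extending the pair. Flipping a whole tail of `u` preserves being `E*_S`-related to `v` but
destroys `E₀`, so two inequivalent points would have the same value. -/
lemma exists_extension_ne (hreg : κ.IsRegular) (hS' : S' ⊆ limits κ) (hD : IsComeager D)
    (hdec : DecidedOn D f) (hred : ∀ η ξ, ERel S' (f η) (f ξ) → ERel S η ξ)
    {x y : Space κ} {α : Below κ} (hxy : EStarUpTo S α x y) (γ : Below κ) :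
    ∃ x' y' α' ε, γ < α' ∧ α ≤ α' ∧ AgreeBelow α x x' ∧ AgreeBelow α y y' ∧
      EStarUpTo S α' x' y' ∧ γ < ε ∧
      ∀ u ∈ D, ∀ v ∈ D, AgreeBelow α' x' u → AgreeBelow α' y' v → f u ε ≠ f v ε := by
  by_contra! hcon
  have key : ∀ u ∈ D, ∀ v ∈ D, AgreeBelow α x u → AgreeBelow α y v → EStar S u v →
      ∀ ε, γ < ε → f u ε = f v ε := by
    intro u hu v hv hxu hyv huv ε hε
    obtain ⟨ε', hε'⟩ := exists_above hreg ε
    obtain ⟨δ₁, hδ₁⟩ := hdec u hu ε'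
    obtain ⟨δ₂, hδ₂⟩ := hdec v hv ε'
    obtain ⟨α', hα'⟩ := exists_above hreg (max (max γ α) (max δ₁ δ₂))
    simp only [max_lt_iff] at hα'
    obtain ⟨u', hu', v', hv', huu', hvv', he⟩ := hcon u v α' ε hα'.1.1 hα'.1.2.le hxu hyv
      (fun δ hδ _ => huv δ hδ) hε
    rw [hδ₁ u' hu' (huu'.mono hα'.2.1.le) ε hε', hδ₂ v' hv' (hvv'.mono hα'.2.2.le) ε hε', he]
  classical
  obtain ⟨γ', hγ'⟩ := exists_above hreg γ
  obtain ⟨u₀, hu₀, hxu₀⟩ := hD.exists_agreeBelow hreg x α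
  obtain ⟨δ₀, hδ₀⟩ := hdec u₀ hu₀ γ'
  obtain ⟨δ, hδ⟩ := exists_above hreg (max δ₀ α)
  simp only [max_lt_iff] at hδ
  -- The flip starts at `δ`, beyond the segment deciding `f` up to and including `γ`.
  let t : Space κ := fun γ => decide (δ ≤ γ)
  obtain ⟨u, ⟨⟨hu, hv⟩, hw⟩, huu⟩ := ((hD.inter hreg
    (hD.preimage_translate hreg (diffBelow α x y))).inter hreg
    (hD.preimage_translate hreg t)).exists_agreeBelow hreg u₀ δ
  set v := translate (diffBelow α x y) u with hvdef
  set w := translate t u with hwdef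
  have huw : AgreeBelow δ u w := fun γ hγ => by simp [hwdef, translate, t, not_le.2 hγ]
  have hxu : AgreeBelow α x u := hxu₀.trans (huu.mono hδ.2.le)
  have hxw : AgreeBelow α x w := hxu.trans (huw.mono hδ.2.le)
  have hyv : AgreeBelow α y v := agreeBelow_translate_diffBelow y hxu
  have huv : ∀ γ, α ≤ γ → u γ = v γ := fun γ hγ => (translate_diffBelow_of_le x y u hγ).symm
  have hwv : EStar S w v := by
    intro η hη
    rcases le_or_gt η α with hle | hlt
    · exact (hxy.congr hxw hyv) η hη hle
    · rcases le_or_gt η δ with hle | hlt'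
      · refine ⟨α, hlt, false, fun γ hγ => ?_⟩
        simp [← huw γ (hγ.2.trans_le hle), huv γ hγ.1.le]
      · refine ⟨δ, hlt', true, fun γ hγ => ?_⟩
        have : w γ = !u γ := by simp [hwdef, translate, t, hγ.1.le]
        simp [this, huv γ (hδ.2.trans hγ.1).le]
  -- Up to `γ` by continuity; beyond `γ` because both agree with `f v`.
  have hfeq : f u = f w := by
    funext ε
    rcases le_or_gt ε γ with hle | hlt
    · have hε := hle.trans_lt hγ'
      rw [← hδ₀ u hu (huu.mono hδ.1.le) ε hε,
        ← hδ₀ w hw ((huu.trans huw).mono hδ.1.le) ε hε]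
    · rw [key u hu v hv hxu hyv ((hxy.congr hxu hyv).eStar huv) ε hlt,
        key w hw v hv hxw hyv hwv ε hlt]
  have huw' : ERel S u w := hred u w (hfeq ▸ (equivalence_eRel hreg hS').refl (f u))
  obtain ⟨b, hb⟩ := huw'.2
  obtain ⟨c, hc⟩ := exists_above hreg (max b δ)
  simp only [max_lt_iff] at hc
  refine absurd (hb (?_ : u c ≠ w c)) (not_le.2 hc.1)
  simp [hwdef, translate, t, hc.2.le]

lemma exists_extension (hreg : κ.IsRegular) (hS' : S' ⊆ limits κ) (hD : IsComeager D)
    (hdec : DecidedOn D f) (hred : ∀ η ξ, ERel S η ξ ↔ ERel S' (f η) (f ξ))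
    {x y : Space κ} {α : Below κ} (hxy : EStarUpTo S α x y) (γ : Below κ) :
    ∃ x' y' α' ε₁ ε₂, γ < α' ∧ α ≤ α' ∧ AgreeBelow α x x' ∧ AgreeBelow α y y' ∧
      EStarUpTo S α' x' y' ∧ γ < ε₁ ∧ γ < ε₂ ∧
      ∀ u ∈ D, ∀ v ∈ D, AgreeBelow α' x' u → AgreeBelow α' y' v →
        f u ε₁ = f v ε₁ ∧ f u ε₂ ≠ f v ε₂ := by
  obtain ⟨x₁, y₁, α₁, ε₁, h1, h2, h3, h4, h5, h6, h7⟩ :=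
    exists_extension_eq hreg hD hdec (fun η ξ => (hred η ξ).1) hxy γ
  obtain ⟨x₂, y₂, α₂, ε₂, k1, k2, k3, k4, k5, k6, k7⟩ :=
    exists_extension_ne hreg hS' hD hdec (fun η ξ => (hred η ξ).2) h5 γ
  exact ⟨x₂, y₂, α₂, ε₁, ε₂, k1, h2.trans k2, h3.trans (k3.mono h2), h4.trans (k4.mono h2),
    k5, h6, k6, fun u hu v hv hxu hyv =>
      ⟨h7 u hu v hv (k3.trans (hxu.mono k2)) (k4.trans (hyv.mono k2)), k7 u hu v hv hxu hyv⟩⟩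

end Reduction

/-! ### Nonreducibility -/

/-- There are only `κ` many pairs of conditions of the same length. -/
lemma exists_enumeration (hreg : κ.IsRegular) (hpow : κ ^< κ = κ) :
    ∃ e : Below κ → Space κ × Space κ × Below κ, ∀ x y α, ∃ i, (e i).2.2 = α ∧
      AgreeBelow α (e i).1 x ∧ AgreeBelow α (e i).2.1 y := by
  classical
  have := nonempty_below hreg
  have hfun : ∀ α : Below κ, #(Iio α → Bool) ≤ κ := by
    intro α
    have h1 : #(Iio α → Bool) = 2 ^ #(Iio α) := by simp
    rw [h1]
    exact (power_le_power_right ((natCast_lt_aleph0 (n := 2)).le.trans hreg.aleph0_le)).trans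
      ((le_powerlt κ (mk_Iio_below_lt α)).trans hpow.le)
  have hcard : #(Σ α : Below κ, (Iio α → Bool) × (Iio α → Bool)) ≤ #(Below κ) := by
    rw [mk_sigma]
    refine (sum_le_mk_mul_iSup _).trans ?_
    rw [mk_ord_toType]
    refine (mul_le_mul_right (ciSup_le' fun α => ?_) κ).trans (mul_eq_self hreg.aleph0_le).le
    rw [mk_prod, lift_id]
    exact (mul_le_mul' (hfun α) (hfun α)).trans (mul_eq_self hreg.aleph0_le).le
  obtain ⟨g⟩ := Cardinal.le_def .. |>.1 hcard
  have : Nonempty (Σ α : Below κ, (Iio α → Bool) × (Iio α → Bool)) :=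
    ⟨⟨Classical.arbitrary _, fun _ => true, fun _ => true⟩⟩
  have hsurj := Function.invFun_surjective g.injective
  let ext : ∀ α : Below κ, (Iio α → Bool) → Space κ := fun α p γ =>
    if h : γ < α then p ⟨γ, h⟩ else false
  have hext : ∀ α (x : Space κ), AgreeBelow α (ext α fun γ => x γ.1) x :=
    fun α x γ hγ => dif_pos hγ
  refine ⟨fun i => (ext _ (Function.invFun g i).2.1, ext _ (Function.invFun g i).2.2,
    (Function.invFun g i).1), fun x y α => ?_⟩
  obtain ⟨i, hi⟩ := hsurj ⟨α, fun γ => x γ.1, fun γ => y γ.1⟩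
  refine ⟨i, ?_⟩
  beta_reduce
  rw [hi]
  exact ⟨rfl, hext α x, hext α y⟩

lemma exists_limit_of_chain {x : ℕ → Space κ} {β : ℕ → Below κ} (hβ : Monotone β)
    (h : ∀ n, AgreeBelow (β n) (x n) (x (n + 1))) :
    ∃ z, ∀ n, AgreeBelow (β n) (x n) z := by
  have hle : ∀ n m, n ≤ m → AgreeBelow (β n) (x n) (x m) := by
    intro n m hnm
    induction m, hnm using Nat.le_induction with
    | base => exact AgreeBelow.refl _ _
    | succ m hm ih => exact ih.trans ((h m).mono (hβ hm))
  refine ⟨glue (x 0) fun n => (x n, β n), agreeBelow_glue (x 0) (fun n => (x n, β n)) ?_⟩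
  intro n m
  rcases le_total n m with hnm | hnm
  · exact (hle n m hnm).mono (min_le_left _ _)
  · exact (hle m n hnm).symm.mono (min_le_right _ _)

/-- If `S' \ S` is `ω`-stationary, then `E_S` is not Borel reducible to `E_{S'}`. -/
theorem not_borelReducible_eRel (hκ : ℵ₀ < κ) (hpow : κ ^< κ = κ) {S S' : Set (Below κ)}
    (hS : S ⊆ limits κ) (hS' : S' ⊆ limits κ) (hst : IsOmegaStationary (S' \ S)) :
    ¬ BorelReducible (ERel S) (ERel S') := by
  have hreg := isRegular_of_powerlt hκ hpow
  rintro ⟨f, hf, hred⟩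
  obtain ⟨D, hD, hdec⟩ := hf.exists_isComeager hreg
  obtain ⟨e, he⟩ := exists_enumeration hreg hpow
  -- Pairs are handled through their indices in `e`, so that the extension step becomes a function
  -- on `κ` under which points can be closed.
  have hstep : ∀ i γ, ∃ j ε₁ ε₂, EStarUpTo S (e i).2.2 (e i).1 (e i).2.1 →
      γ < (e j).2.2 ∧ (e i).2.2 ≤ (e j).2.2 ∧ AgreeBelow (e i).2.2 (e i).1 (e j).1 ∧
      AgreeBelow (e i).2.2 (e i).2.1 (e j).2.1 ∧
      EStarUpTo S (e j).2.2 (e j).1 (e j).2.1 ∧ γ < ε₁ ∧ γ < ε₂ ∧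
      ∀ u ∈ D, ∀ v ∈ D, AgreeBelow (e j).2.2 (e j).1 u → AgreeBelow (e j).2.2 (e j).2.1 v →
        f u ε₁ = f v ε₁ ∧ f u ε₂ ≠ f v ε₂ := by
    intro i γ
    by_cases hi : EStarUpTo S (e i).2.2 (e i).1 (e i).2.1
    · obtain ⟨x', y', α', ε₁, ε₂, h1, h2, h3, h4, h5, h6, h7, h8⟩ :=
        exists_extension hreg hS' hD hdec hred hi γ
      obtain ⟨j, rfl, hx, hy⟩ := he x' y' α'
      exact ⟨j, ε₁, ε₂, fun _ => ⟨h1, h2, h3.trans (hx.symm.mono h2), h4.trans (hy.symm.mono h2),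
        h5.congr hx.symm hy.symm, h6, h7, fun u hu v hv hu' hv' =>
          h8 u hu v hv (hx.symm.trans hu') (hy.symm.trans hv')⟩⟩
    · exact ⟨i, γ, γ, fun h => absurd h hi⟩
  choose J ε₁ ε₂ hJ using hstep
  have := nonempty_below hreg
  let bot : Below κ := WellFounded.min wellFounded_lt univ univ_nonempty
  have hbot : IsMin bot := fun b _ => not_lt.1 (WellFounded.not_lt_min _ _ (mem_univ b))
  -- The pair of empty conditions is vacuously good, since `0` is not a limit.
  obtain ⟨i₀, hi₀, -, -⟩ := he (fun _ => false) (fun _ => false) bot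
  obtain ⟨α, ⟨hα', hα⟩, ⟨s, hs⟩, hcl⟩ := hst _ (isOmegaCub_closurePoints hreg hκ fun i γ =>
    max (max i₀ (max (J i γ) (e (J i γ)).2.2)) (max (ε₁ i γ) (ε₂ i γ)))
  simp only [max_lt_iff] at hcl
  let I : ℕ → Below κ := fun n => Nat.rec i₀ (fun n i => J i (s n)) n
  have hI : ∀ n, I n < α := by
    intro n
    cases n with
    | zero => exact (hcl _ (hs.lt 0) _ (hs.lt 0)).1.1
    | succ n =>
      have : I n < α := by
        induction n with
        | zero => exact (hcl _ (hs.lt 0) _ (hs.lt 0)).1.1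
        | succ n ih => exact (hcl _ ih _ (hs.lt n)).1.2.1
      exact (hcl _ this _ (hs.lt n)).1.2.1
  have hgood : ∀ n, EStarUpTo S (e (I n)).2.2 (e (I n)).1 (e (I n)).2.1 := by
    intro n
    induction n with
    | zero =>
      intro δ hδ hle
      change δ ≤ (e i₀).2.2 at hle
      rw [hi₀] at hle
      exact absurd (hbot.mono hle) (hS hδ).1
    | succ n ih => exact (hJ _ (s n) ih).2.2.2.2.1
  have hmono : Monotone fun n => (e (I n)).2.2 :=
    monotone_nat_of_le_succ fun n => (hJ _ (s n) (hgood n)).2.1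
  obtain ⟨x, hx⟩ := exists_limit_of_chain (x := fun n => (e (I n)).1) hmono
    fun n => (hJ _ (s n) (hgood n)).2.2.1
  obtain ⟨y, hy⟩ := exists_limit_of_chain (x := fun n => (e (I n)).2.1) hmono
    fun n => (hJ _ (s n) (hgood n)).2.2.2.1
  have hlen : ∀ n, (e (I (n + 1))).2.2 < α := fun n => (hcl _ (hI n) _ (hs.lt n)).1.2.2
  have hxy : EStarUpTo S α x y := by
    intro δ hδ hle
    -- Here `α ∉ S` is used: no demand is made at the limit itself.
    have hlt : δ < α := lt_of_le_of_ne hle fun h => hα (h ▸ hδ)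
    obtain ⟨n, hn⟩ := hs.exists_lt hlt
    have hn' := hn.trans (hJ _ (s n) (hgood n)).1
    exact (hgood (n + 1) δ hδ hn'.le).congr ((hx (n + 1)).mono hn'.le) ((hy (n + 1)).mono hn'.le)
  obtain ⟨u, ⟨hu, hv⟩, hxu⟩ := (hD.inter hreg
    (hD.preimage_translate hreg (diffBelow α x y))).exists_agreeBelow hreg x α
  have hyv := agreeBelow_translate_diffBelow y hxu
  have huv := (hxy.congr hxu hyv).eRel fun γ hγ => (translate_diffBelow_of_le x y u hγ).symm
  -- Since `α ∈ S'`, the difference of the values is constant on `(β, α)`, yet a late stage places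
  -- both an agreement and a disagreement there.
  obtain ⟨β, hβ, c, hc⟩ := ((hred _ _).1 huv).1 α hα'
  obtain ⟨n, hn⟩ := hs.exists_lt hβ
  obtain ⟨-, -, -, -, -, h1, h2, h3⟩ := hJ _ (s n) (hgood n)
  obtain ⟨heq, hne⟩ := h3 u hu _ hv ((hx (n + 1)).trans (hxu.mono (hlen n).le))
    ((hy (n + 1)).trans (hyv.mono (hlen n).le))
  have hbd := hcl _ (hI n) _ (hs.lt n)
  have hc1 := hc _ ⟨hn.trans h1, hbd.2.1⟩
  have hc2 := hc _ ⟨hn.trans h2, hbd.2.2⟩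
  rw [heq, Bool.xor_self] at hc1
  rw [← hc1] at hc2
  exact hne (by simpa using hc2)

/-! ### The antichain -/

lemma IsOmegaStationary.mono {S T : Set (Below κ)} (h : IsOmegaStationary S) (hST : S ⊆ T) :
    IsOmegaStationary T :=
  fun C hC => (h C hC).mono (inter_subset_inter_left C hST)

lemma mk_space (κ : Cardinal.{u}) : #(Space κ) = 2 ^ κ := by
  change #(Below κ → Bool) = _
  simp

/-- At a coordinate `α` where `η` and `ξ` differ, `(α, !(ξ α))` belongs to `A_ξ` and not to `A_η`;
disjointness of the `S i` does the rest. -/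
lemma exists_subset_unionOf_diff {S : Below κ → Set (Below κ)}
    (hS : ∀ i j, i ≠ j → Disjoint (S i) (S j)) (f : Below κ × Bool ≃ Below κ) {η ξ : Space κ}
    (h : η ≠ ξ) : ∃ i, S i ⊆ unionOf S f ξ \ unionOf S f η := by
  obtain ⟨α, hα⟩ := Function.ne_iff.1 h
  refine ⟨f (α, !(ξ α)), fun β hβ => ⟨mem_biUnion (mem_image_of_mem f ?_) hβ, fun hmem => ?_⟩⟩
  · change (_ ∧ _) ∨ (_ ∧ _)
    cases ξ α <;> simp
  · obtain ⟨_, ⟨p, hp, rfl⟩, hβp⟩ := mem_iUnion₂.1 hmem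
    have hfp : f p = f (α, !(ξ α)) := by
      by_contra hne
      exact Set.disjoint_left.1 (hS _ _ hne) hβp hβ
    rw [f.injective hfp] at hp
    change (_ ∧ _) ∨ (_ ∧ _) at hp
    revert hα hp
    cases ξ α <;> cases η α <;> simp

end GenCantor

theorem corollary29 (κ : Cardinal.{u}) (hκ : ℵ₀ < κ) (hpow : κ ^< κ = κ) :
    ∃ (S : GenCantor.Below κ → Set (GenCantor.Below κ))
      (f : GenCantor.Below κ × Bool ≃ GenCantor.Below κ),
      (∀ i, S i ⊆ GenCantor.limits κ) ∧
      (∀ i, GenCantor.IsOmegaStationary (S i)) ∧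
      (∀ i j, i ≠ j → Disjoint (S i) (S j)) ∧
      (∀ η : GenCantor.Space κ,
        GenCantor.IsBorelEquiv (GenCantor.ERel (GenCantor.unionOf S f η))) ∧
      (∀ η ξ : GenCantor.Space κ, η ≠ ξ →
        ¬ GenCantor.BorelReducible (GenCantor.ERel (GenCantor.unionOf S f η))
            (GenCantor.ERel (GenCantor.unionOf S f ξ))) ∧
      #(Set.range fun η : GenCantor.Space κ =>
          GenCantor.ERel (GenCantor.unionOf S f η)) = 2 ^ κ := by
  have hreg := GenCantor.isRegular_of_powerlt hκ hpow
  obtain ⟨S, hlim, hstat, hdisj⟩ := GenCantor.exists_disjoint_isOmegaStationary hreg hκ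
  obtain ⟨f⟩ : Nonempty (GenCantor.Below κ × Bool ≃ GenCantor.Below κ) := by
    rw [← Cardinal.lift_mk_eq'.{u, u}, lift_id, lift_id, mk_prod, mk_ord_toType, mk_bool, lift_uzero,
      lift_ofNat]
    exact mul_eq_left hκ.le ((natCast_lt_aleph0 (n := 2)).le.trans hκ.le) two_ne_zero
  have hU : ∀ η, GenCantor.unionOf S f η ⊆ GenCantor.limits κ := fun η =>
    iUnion₂_subset fun i _ => hlim i
  have hnot : ∀ η ξ : GenCantor.Space κ, η ≠ ξ →
      ¬ GenCantor.BorelReducible (GenCantor.ERel (GenCantor.unionOf S f η))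
        (GenCantor.ERel (GenCantor.unionOf S f ξ)) := by
    intro η ξ hne
    obtain ⟨i, hi⟩ := GenCantor.exists_subset_unionOf_diff hdisj f hne
    exact GenCantor.not_borelReducible_eRel hκ hpow (hU η) (hU ξ) ((hstat i).mono hi)
  refine ⟨S, f, hlim, hstat, hdisj, fun η => GenCantor.isBorelEquiv_eRel hreg (hU η), hnot, ?_⟩
  -- Injectivity follows from nonreducibility, since every relation reduces to itself.
  rw [mk_range_eq _ fun η ξ heq => ?_, GenCantor.mk_space]
  by_contra hne
  refine hnot η ξ hne ?_
  have heq' : GenCantor.ERel (GenCantor.unionOf S f η) =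
    GenCantor.ERel (GenCantor.unionOf S f ξ) := heq
  rw [heq']
  exact GenCantor.borelReducible_refl _
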